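/- Let $D$ be a finite alphabet carrying the structure of an abelian group (for instance $\mathbb Z/|D|\mathbb Z$), let $|E|=2$, let $\mathcal D\subseteq D^n$, and let $f:\mathcal D\to E$ be a boolean function. For an integer $k>0$ let $f^{(k)}:\mathcal D^k\to E^k$, $f^{(k)}(x^1,\dots,x^k)=(f(x^1),\dots,f(x^k))$, regarded as a function of $kn$ variables. For a function $g$ on a set of inputs $x$ with letters in $D$, let $Q_\epsilon(g)$ be the minimum number of queries $O_x:|i,b,w\rangle\mapsto|i,b+x_i,w\rangle$ made by a quantum algorithm (arbitrary input-independent unitaries on a finite-dimensional space interleaved with queries, then a measurement; an index value for which $O_x$ acts as the identity is also allowed) which on every input $x$ in the domain of $g$ outputs $g(x)$ with probability at least $1-\epsilon$; $Q_\epsilon(g)=\infty$ if there is no such algorithm (in particular if $\epsilon<0$ and the domain is non-empty). Let $F(x,y)=1$ if $f(x)=f(y)$ and $0$ otherwise, let $J$ be the all-ones matrix, and let $\Delta_i(x,y)=1$ if $x_i=y_i$ and $0$ otherwise ($x,y\in\mathcal D$). The additive adversary bound is $$\mathrm{ADV}(F)=\max\bigl\{\,\|\Gamma\circ(J-F)\|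 \;:\; \Gamma \text{ Hermitian},\ I\pm\Gamma\circ(J-\Delta_i)\succeq 0 \text{ for all } i\in[n]\,\bigr\},$$ where $\circ$ is the entrywise product and $\|\cdot\|$ the spectral norm. Then for every real $0\le\delta<1$ and all integers $k,K>0$, $$Q_{\,1-\left(e^{1/K}(1+\sqrt\delta)/2\right)^k}\bigl(f^{(k)}\bigr)\;\ge\;\frac{k\,\delta}{K(1-\delta)}\,\mathrm{ADV}(F).$$ -/

import Mathlib

open scoped ENNReal Matrix ComplexOrder

/-! ## Quantum query algorithms -/

namespace QuantumQuery

/-- Computational basis of the state space: a query index (`none` means that no variable is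
queried), an answer register holding a letter of the alphabet `D`, and a workspace of finite
dimension `m`. -/
abbrev BasisState (ι D : Type*) (m : ℕ) : Type _ := Option ι × D × Fin m

/-- The shift of the answer register: by `x i` if the index register holds `some i`, and by `0` if
it holds `none`. -/
def shift {ι D : Type*} [AddCommGroup D] (x : ι → D) : Option ι → D
  | none => 0
  | some i => x i

/-- The query operator `O_x : |i, b, w⟩ ↦ |i, b + x_i, w⟩` (the identity where `i = none`), acting on
the vector of amplitudes: the new amplitude of `|i, b, w⟩` is the old one of `|i, b - x_i, w⟩`. -/
def applyQuery {ι D : Type*} [AddCommGroup D] {m : ℕ} (x : ι → D)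
    (ψ : BasisState ι D m → ℂ) : BasisState ι D m → ℂ :=
  fun s => ψ (s.1, s.2.1 - shift x s.1, s.2.2)

/-- A quantum query algorithm for inputs `x : ι → D` with outputs in `O`: it starts in a basis state,
alternates input-independent unitaries with queries,
`U_T O_x U_{T-1} O_x ⋯ U_1 O_x U_0 |start⟩`, and finally measures in the computational basis and
outputs the label of the basis state observed. -/
structure Algorithm (ι D O : Type*) [Fintype ι] [DecidableEq ι] [Fintype D] [DecidableEq D] where
  /-- the number `T` of queries -/
  queries : ℕ
  /-- the dimension of the workspace -/
  workDim : ℕ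
  /-- the initial basis state -/
  start : BasisState ι D workDim
  /-- the unitaries; only `U 0, …, U T` are used -/
  U : ℕ → Matrix.unitaryGroup (BasisState ι D workDim) ℂ
  /-- the output attached to each outcome of the final measurement -/
  output : BasisState ι D workDim → O

namespace Algorithm

variable {ι D O : Type*} [Fintype ι] [DecidableEq ι] [Fintype D] [DecidableEq D] [AddCommGroup D]

/-- The state on input `x` after `t` queries and the unitary following the `t`-th query. -/
def state (A : Algorithm ι D O) (x : ι → D) : ℕ → BasisState ι D A.workDim → ℂ
  | 0 => (A.U 0).1 *ᵥ Pi.single A.start 1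
  | t + 1 => (A.U (t + 1)).1 *ᵥ applyQuery x (state A x t)

open Classical in
/-- The probability that the algorithm outputs `o` on input `x`. -/
noncomputable def outputProb (A : Algorithm ι D O) (x : ι → D) (o : O) : ℝ :=
  ∑ s with A.output s = o, ‖A.state x A.queries s‖ ^ 2

/-- On every input of the domain the algorithm outputs the value of `g` with probability at least
`1 - ε`. -/
def Computes (A : Algorithm ι D O) {S : Finset (ι → D)} (g : S → O) (ε : ℝ) : Prop :=
  ∀ x : S, 1 - ε ≤ A.outputProb x.1 (g x)

end Algorithm

/-- `Q_ε(g)`: the minimum number of queries of a quantum algorithm computing `g` with error at most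
`ε` on every input (`⊤` if there is no such algorithm). -/
noncomputable def queryComplexity {ι D O : Type*} [Fintype ι] [DecidableEq ι] [Fintype D]
    [DecidableEq D] [AddCommGroup D] (ε : ℝ) {S : Finset (ι → D)} (g : S → O) : ℕ∞ :=
  ⨅ (A : Algorithm ι D O) (_ : A.Computes g ε), (A.queries : ℕ∞)

/-! ## Independent copies of a function -/

/-- The `p`-th block of an input made of `k` blocks of length `n`. -/
def block {n k : ℕ} {D : Type*} (z : Fin k × Fin n → D) (p : Fin k) : Fin n → D :=
  fun q => z (p, q)

/-- The domain `S ^ k`, as a set of inputs with `k * n` variables. -/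
def powDomain {n : ℕ} {D : Type*} [Fintype D] [DecidableEq D] (S : Finset (Fin n → D)) (k : ℕ) :
    Finset (Fin k × Fin n → D) :=
  {z | ∀ p, block z p ∈ S}

/-- `f^(k) (x¹, …, xᵏ) = (f x¹, …, f xᵏ)`. -/
def copies {n : ℕ} {D E : Type*} [Fintype D] [DecidableEq D] {S : Finset (Fin n → D)}
    (f : S → E) (k : ℕ) : powDomain S k → Fin k → E :=
  fun z p => f ⟨block z.1 p, (Finset.mem_filter.mp z.2).2 p⟩

/-! ## The additive adversary bound -/

/-- The all-ones matrix `J`. -/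
def allOnes (X : Type*) : Matrix X X ℂ := Matrix.of fun _ _ => 1

/-- `Δ_i (x, y) = 1` if `x_i = y_i`, and `0` otherwise. -/
def agree {ι D : Type*} [DecidableEq D] (S : Finset (ι → D)) (i : ι) : Matrix S S ℂ :=
  Matrix.of fun x y => if x.1 i = y.1 i then 1 else 0

/-- The Gram matrix `F (x, y) = 1` if `f x = f y`, and `0` otherwise. -/
def functionGram {ι D E : Type*} [DecidableEq E] {S : Finset (ι → D)} (f : S → E) :
    Matrix S S ℂ :=
  Matrix.of fun x y => if f x = f y then 1 else 0

/-- `Γ` is hermitian and `I ± Γ ∘ (J - Δ_i) ⪰ 0` for every `i` (entrywise product). -/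
def IsAdversaryMatrix {ι D : Type*} [DecidableEq ι] [DecidableEq D] [Fintype ι]
    {S : Finset (ι → D)} (Γ : Matrix S S ℂ) : Prop :=
  Γ.IsHermitian ∧ ∀ i : ι,
    (1 + Γ ⊙ (allOnes S - agree S i)).PosSemidef ∧
    (1 - Γ ⊙ (allOnes S - agree S i)).PosSemidef

/-- The additive adversary bound `ADV(σ)`: the maximum of the spectral norm `‖Γ ∘ (J - σ)‖` over
adversary matrices `Γ`. -/
noncomputable def additiveAdversary {ι D : Type*} [Fintype ι] [DecidableEq ι] [DecidableEq D]
    {S : Finset (ι → D)} (σ : Matrix S S ℂ) : ℝ≥0∞ :=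
  ⨆ (Γ : Matrix S S ℂ) (_ : IsAdversaryMatrix Γ),
    ENNReal.ofReal ‖Matrix.toEuclideanCLM (𝕜 := ℂ) (Γ ⊙ (allOnes S - σ))‖

end QuantumQuery

namespace QuantumQuery

/-! ## Spectral norm of a hermitian matrix -/

/-! The additive adversary matrix is turned into a multiplicative one. Put H = Γ ∘ (J - F), d = ‖H‖
and, for μ > 0, M = (d + μ) I - H, so that M ⪰ μ I. Since H vanishes inside the fibres of a boolean
f, some unit vector v has ⟨v, H v⟩ = +d, hence ⟨v, M v⟩ = μ.

Weight the states of an algorithm for f^(k) by the product amplitudes of v and track their energy,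
the pairing of M^{⊗k} with their Gram matrix. It starts at μ^k (`energy_weightedState_zero`), and a
query multiplies it by at most 1 + 2/μ (`energy_weightedState_succ_le`). With P_o the projection
onto the fibre over o, M ⪰ c P_o for c = μ(2d + μ)/(d + μ) (`posSemidef_smul_one_sub_sub_fibre`).
Tensoring this inequality shows that success probability η forces a final energy of at least c^k η
(`sum_norm_sq_mul_outputProb_le_energy`). Comparison gives η ≤ ((d + μ)/(2d + μ))^k (1 + 2/μ)^T for
T queries, and μ = 2d√δ/(1 - √δ) makes the first base (1 + √δ)/2. -/

theorem exists_unit_abs_reApplyInnerSelf_eq_norm {V : Type*} [NormedAddCommGroup V]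
    [InnerProductSpace ℂ V] [FiniteDimensional ℂ V] [Nontrivial V] (T : V →L[ℂ] V)
    (hT : (T : V →ₗ[ℂ] V).IsSymmetric) :
    ∃ x : V, ‖x‖ = 1 ∧ |T.reApplyInnerSelf x| = ‖T‖ := by
  have : ProperSpace V := FiniteDimensional.proper ℂ V
  let _ : NormedSpace ℝ V := NormedSpace.restrictScalars ℝ ℂ V
  have hc : Continuous fun x : V => |T.reApplyInnerSelf x| :=
    (T.reApplyInnerSelf_continuous).abs
  obtain ⟨x₀, hx₀, hmax⟩ := (isCompact_sphere (0 : V) 1).exists_isMaxOn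
    ((NormedSpace.sphere_nonempty).2 zero_le_one) hc.continuousOn
  have hx1 : ‖x₀‖ = 1 := by simpa using hx₀
  refine ⟨x₀, hx1, le_antisymm ?_ ?_⟩
  · have := T.rayleighQuotient_le_norm x₀
    simpa [ContinuousLinearMap.rayleighQuotient, hx1] using this
  · rw [T.norm_eq_iSup_rayleighQuotient hT]
    refine ciSup_le fun x => ?_
    rcases eq_or_ne x 0 with rfl | hx
    · simp
    · have hx' : ‖x‖ ≠ 0 := norm_ne_zero_iff.2 hx
      have hcx : ((‖x‖⁻¹ : ℝ) : ℂ) ≠ 0 := by simpa using hx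
      rw [← T.rayleigh_smul x hcx]
      have hn : ‖((‖x‖⁻¹ : ℝ) : ℂ) • x‖ = 1 := by
        rw [norm_smul]; simp [hx']
      have := hmax (show ((‖x‖⁻¹ : ℝ) : ℂ) • x ∈ Metric.sphere (0 : V) 1 by simpa using hn)
      rw [ContinuousLinearMap.rayleighQuotient, hn]
      simpa using this

section Hermitian

variable {X : Type*} [Fintype X]

theorem star_dotProduct_self_eq_norm_sq (x : X → ℂ) :
    star x ⬝ᵥ x = ((‖WithLp.toLp 2 x‖ ^ 2 : ℝ) : ℂ) := by
  rw [EuclideanSpace.norm_sq_eq]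
  simp [dotProduct, Complex.conj_mul']

variable [DecidableEq X]

theorem reApplyInnerSelf_toEuclideanCLM (A : Matrix X X ℂ) (x : EuclideanSpace ℂ X) :
    (Matrix.toEuclideanCLM (𝕜 := ℂ) A).reApplyInnerSelf x
      = (star (x.ofLp) ⬝ᵥ A *ᵥ x.ofLp).re := by
  rw [ContinuousLinearMap.reApplyInnerSelf_apply, ← inner_conj_symm,
    EuclideanSpace.inner_eq_star_dotProduct, Matrix.ofLp_toEuclideanCLM, dotProduct_comm]
  simp

theorem isSymmetric_toEuclideanCLM {A : Matrix X X ℂ} (hA : A.IsHermitian) :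
    ((Matrix.toEuclideanCLM (𝕜 := ℂ) A :
      EuclideanSpace ℂ X →L[ℂ] EuclideanSpace ℂ X) : EuclideanSpace ℂ X →ₗ[ℂ] _).IsSymmetric := by
  rw [Matrix.coe_toEuclideanCLM_eq_toEuclideanLin]
  exact Matrix.isSymmetric_toEuclideanLin_iff.2 hA

theorem posSemidef_norm_smul_one_sub {A : Matrix X X ℂ} (hA : A.IsHermitian) :
    (((‖Matrix.toEuclideanCLM (𝕜 := ℂ) A‖ : ℝ) : ℂ) • (1 : Matrix X X ℂ) - A).PosSemidef := by
  set d := ‖Matrix.toEuclideanCLM (𝕜 := ℂ) A‖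
  have hH : (((d : ℝ) : ℂ) • (1 : Matrix X X ℂ) - A).IsHermitian := by
    refine Matrix.IsHermitian.sub ?_ hA
    rw [Matrix.IsHermitian, Matrix.conjTranspose_smul]
    simp
  refine Matrix.PosSemidef.of_dotProduct_mulVec_nonneg hH fun x => ?_
  have him := hH.im_star_dotProduct_mulVec_self x
  rw [Complex.le_def]
  refine ⟨?_, by simpa using him.symm⟩
  have h1 := (Matrix.toEuclideanCLM (𝕜 := ℂ) A).rayleighQuotient_le_norm (WithLp.toLp 2 x)
  rw [ContinuousLinearMap.rayleighQuotient, reApplyInnerSelf_toEuclideanCLM] at h1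
  rw [Matrix.sub_mulVec, dotProduct_sub, Matrix.smul_mulVec, Matrix.one_mulVec, dotProduct_smul,
    star_dotProduct_self_eq_norm_sq]
  rcases eq_or_ne x 0 with rfl | hx
  · simp
  · have hp : 0 < ‖WithLp.toLp 2 x‖ ^ 2 := by
      have : WithLp.toLp 2 x ≠ 0 := by simpa using hx
      positivity
    have h2 := (div_le_iff₀ hp).1 ((le_abs_self _).trans h1)
    rw [smul_eq_mul, ← Complex.ofReal_mul, Complex.sub_re, Complex.ofReal_re]
    simpa using h2

end Hermitian

/-! ## Hermitian matrices vanishing inside the fibres of a boolean function -/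

section Bipartite

variable {X E : Type*} [Fintype E] [DecidableEq E]

theorem eq_iff_ne_of_card_eq_two (hE : Fintype.card E = 2) {a b : E} (hab : a ≠ b) (o : E) :
    a = o ↔ b ≠ o := by
  refine ⟨fun h hb => hab (h.trans hb.symm), fun hb => ?_⟩
  by_contra ha
  have : ({a, b, o} : Finset E).card ≤ 2 := hE ▸ Finset.card_le_univ _
  rw [Finset.card_eq_three.2 ⟨a, b, o, hab, ha, hb, rfl⟩] at this
  omega

/-- The sign `1` on the fibre of `f` over `o`, and `-1` outside it. -/
def fibreSign (f : X → E) (o : E) (x : X) : ℂ := if f x = o then 1 else -1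

theorem fibreSign_mul_fibreSign (hE : Fintype.card E = 2) (f : X → E) (o : E) (x y : X) :
    fibreSign f o x * fibreSign f o y = if f x = f y then 1 else -1 := by
  unfold fibreSign
  by_cases h : f x = f y
  · simp only [h]; split_ifs <;> norm_num
  · have := eq_iff_ne_of_card_eq_two hE h o
    by_cases hx : f x = o
    · rw [if_pos hx, if_neg (this.1 hx), if_neg h, one_mul]
    · have hy : f y = o := by by_contra hy; exact hx (this.2 hy)
      simp [hx, hy]

omit [Fintype E] in
theorem star_fibreSign (f : X → E) (o : E) (x : X) :
    star (fibreSign f o x) = fibreSign f o x := by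
  unfold fibreSign; split_ifs <;> simp

variable [Fintype X]

theorem posSemidef_ite_fibre (hE : Fintype.card E = 2) (f : X → E) :
    (Matrix.of fun x y => if f x = f y then 1 else -1 : Matrix X X ℂ).PosSemidef := by
  obtain ⟨o⟩ : Nonempty E := Fintype.card_pos_iff.1 (by omega)
  convert Matrix.posSemidef_vecMulVec_self_star (fibreSign f o) using 1
  ext x y
  simp only [Matrix.of_apply, Matrix.vecMulVec_apply, Pi.star_apply, star_fibreSign,
    fibreSign_mul_fibreSign hE]

variable [DecidableEq X]

/-- Deleting the entries inside the fibres of a boolean function preserves `-1 ≤ B ≤ 1`. -/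
theorem posSemidef_one_add_of_offFibre (hE : Fintype.card E = 2) (f : X → E) {B B' : Matrix X X ℂ}
    (hB' : ∀ x y, B' x y = if f x = f y then 0 else B x y)
    (h₁ : (1 + B).PosSemidef) (h₂ : (1 - B).PosSemidef) : (1 + B').PosSemidef := by
  -- With σ the rank-one sign matrix, 1 on fibre pairs and -1 elsewhere, B' = (B - B ∘ σ)/2. As σ
  -- has unit diagonal, 1 + B' = ((1 + B) + (1 - B) ∘ σ)/2, and Schur's product theorem applies.
  have h := (h₁.add (h₂.hadamard (posSemidef_ite_fibre hE f))).smul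
    (show (0 : ℂ) ≤ 1 / 2 by norm_num [Complex.le_def])
  convert h using 1
  ext x y
  simp only [Matrix.add_apply, Matrix.smul_apply, Matrix.hadamard_apply, Matrix.sub_apply,
    Matrix.of_apply, hB', smul_eq_mul]
  by_cases hxy : x = y
  · subst hxy; simp; ring
  · rw [Matrix.one_apply_ne hxy]
    split_ifs <;> ring

variable {A : Matrix X X ℂ}

/-- The matrix is bipartite: flipping the sign of a vector on one fibre negates its quadratic form.
An extremal vector of value -‖A‖ therefore yields one of value +‖A‖. -/
theorem exists_unit_dotProduct_mulVec_eq_norm (hE : Fintype.card E = 2) (f : X → E)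
    (hA : A.IsHermitian) (hf : ∀ x y, f x = f y → A x y = 0) [Nonempty X] :
    ∃ v : X → ℂ, star v ⬝ᵥ v = 1 ∧
      star v ⬝ᵥ A *ᵥ v = ((‖Matrix.toEuclideanCLM (𝕜 := ℂ) A‖ : ℝ) : ℂ) := by
  obtain ⟨w, hw, hd⟩ := exists_unit_abs_reApplyInnerSelf_eq_norm
    (Matrix.toEuclideanCLM (𝕜 := ℂ) A) (isSymmetric_toEuclideanCLM hA)
  rw [reApplyInnerSelf_toEuclideanCLM] at hd
  have h1 : star w.ofLp ⬝ᵥ w.ofLp = 1 := by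
    rw [star_dotProduct_self_eq_norm_sq]; simp [hw]
  have him : (star w.ofLp ⬝ᵥ A *ᵥ w.ofLp).im = 0 := hA.im_star_dotProduct_mulVec_self _
  rcases abs_choice (star w.ofLp ⬝ᵥ A *ᵥ w.ofLp).re with h | h
  · exact ⟨w.ofLp, h1, Complex.ext (by rw [← hd, h]; simp) (by simpa using him)⟩
  · obtain ⟨o⟩ : Nonempty E := Fintype.card_pos_iff.1 (by omega)
    have hs : ∀ x, fibreSign f o x * fibreSign f o x = 1 := fun x => by
      rw [fibreSign_mul_fibreSign hE]; simp
    have hneg : star (fun x => fibreSign f o x * w.ofLp x) ⬝ᵥ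
        A *ᵥ (fun x => fibreSign f o x * w.ofLp x) = - (star w.ofLp ⬝ᵥ A *ᵥ w.ofLp) := by
      simp only [dotProduct, Matrix.mulVec, Pi.star_apply, star_mul', star_fibreSign,
        Finset.mul_sum, ← Finset.sum_neg_distrib]
      refine Finset.sum_congr rfl fun x _ => Finset.sum_congr rfl fun y _ => ?_
      by_cases hxy : f x = f y
      · simp [hf x y hxy]
      · have := fibreSign_mul_fibreSign hE f o x y
        rw [if_neg hxy] at this
        linear_combination (star (w.ofLp x) * A x y * w.ofLp y) * this
    refine ⟨fun x => fibreSign f o x * w.ofLp x, ?_, ?_⟩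
    · rw [← h1]
      simp only [dotProduct, Pi.star_apply, star_mul', star_fibreSign]
      refine Finset.sum_congr rfl fun x _ => ?_
      linear_combination (star (w.ofLp x) * w.ofLp x) * hs x
    · rw [hneg]
      exact Complex.ext (by rw [← hd, h]; simp) (by simpa using him)

/-- Conjugate d I - A ⪰ 0 by a diagonal matrix equal to √(d/(d+μ)) on the fibre and to its inverse
off it. Entries of A between the fibres are unchanged, while the diagonal becomes d²/(d+μ) on the
fibre and d + μ off it. The subtracted constant is exactly (d + μ) - d²/(d+μ). -/
theorem posSemidef_smul_one_sub_sub_fibre (hE : Fintype.card E = 2) (f : X → E) (o : E)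
    (hf : ∀ x y, f x = f y → A x y = 0) {d μ : ℝ} (hd : 0 < d) (hμ : 0 < μ)
    (hdA : ((d : ℂ) • (1 : Matrix X X ℂ) - A).PosSemidef) :
    (((d + μ : ℝ) : ℂ) • (1 : Matrix X X ℂ) - A -
      ((μ * (2 * d + μ) / (d + μ) : ℝ) : ℂ) •
        Matrix.diagonal fun x => if f x = o then (1 : ℂ) else 0).PosSemidef := by
  set t : X → ℂ := fun x => ((if f x = o then √(d / (d + μ)) else √((d + μ) / d) : ℝ) : ℂ)
    with ht
  have h1 : √(d / (d + μ)) * √(d / (d + μ)) = d / (d + μ) := Real.mul_self_sqrt (by positivity)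
  have h2 : √((d + μ) / d) * √((d + μ) / d) = (d + μ) / d := Real.mul_self_sqrt (by positivity)
  have h3 : √(d / (d + μ)) * √((d + μ) / d) = 1 := by
    rw [← Real.sqrt_mul (by positivity)]
    have : d / (d + μ) * ((d + μ) / d) = 1 := by field_simp
    rw [this, Real.sqrt_one]
  convert hdA.mul_mul_conjTranspose_same (Matrix.diagonal t) using 1
  ext x y
  rw [Matrix.diagonal_conjTranspose, Matrix.mul_diagonal, Matrix.diagonal_mul]
  simp only [Matrix.sub_apply, Matrix.smul_apply, smul_eq_mul, Pi.star_apply]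
  have hst : star (t y) = t y := by simp [ht]
  rw [hst]
  by_cases hxy : x = y
  · subst hxy
    simp only [Matrix.one_apply_eq, Matrix.diagonal_apply_eq, hf x x rfl, ht]
    by_cases hx : f x = o
    · simp only [hx, if_true]
      have : (d + μ) - μ * (2 * d + μ) / (d + μ)
          = √(d / (d + μ)) * d * √(d / (d + μ)) := by
        rw [mul_right_comm, h1]; field_simp; ring
      simpa using congrArg (fun r : ℝ => (r : ℂ)) this
    · simp only [hx, if_false]
      have : (d + μ) = √((d + μ) / d) * d * √((d + μ) / d) := by
        rw [mul_right_comm, h2]; field_simp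
      simpa using congrArg (fun r : ℝ => (r : ℂ)) this
  · simp only [Matrix.one_apply_ne hxy, Matrix.diagonal_apply_ne _ hxy]
    by_cases h : f x = f y
    · simp [hf x y h]
    · have key : t x * t y = 1 := by
        have := eq_iff_ne_of_card_eq_two hE h o
        simp only [ht]
        rw [← Complex.ofReal_mul, ← Complex.ofReal_one]
        congr 1
        by_cases hx : f x = o
        · rw [if_pos hx, if_neg (this.1 hx), h3]
        · have hy : f y = o := by by_contra hy; exact hx (this.2 hy)
          rw [if_neg hx, if_pos hy, mul_comm, h3]
      linear_combination A x y * key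

end Bipartite

/-! ## Tensor products of matrices indexed by functions -/

section Tensor

variable {ι X : Type*} [Fintype ι]

/-- The tensor product of the matrices `N p`, with rows and columns indexed by `ι → X`. -/
def tensor (N : ι → Matrix X X ℂ) : Matrix (ι → X) (ι → X) ℂ :=
  Matrix.of fun z z' => ∏ p, N p (z p) (z' p)

variable [Fintype X] [DecidableEq ι]

theorem posSemidef_hadamard {Z : Type*} [Finite Z] {A B : Matrix Z Z ℂ} (hA : A.PosSemidef)
    (hB : B.PosSemidef) : (A ⊙ B).PosSemidef :=
  hA.hadamard hB

/-- Both claims are carried through one induction, as the telescoping N ⊗ P - N' ⊗ P' = (N - N') ⊗ P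
+ N' ⊗ (P - P') needs P ⪰ 0, obtained from P = P' + (P - P'). -/
theorem posSemidef_prod_sub_prod {N N' : ι → Matrix X X ℂ} (h' : ∀ p, (N' p).PosSemidef)
    (h : ∀ p, (N p - N' p).PosSemidef) (s : Finset ι) :
    (Matrix.of fun z z' : ι → X => ∏ p ∈ s, N' p (z p) (z' p)).PosSemidef ∧
    (Matrix.of fun z z' : ι → X =>
      ∏ p ∈ s, N p (z p) (z' p) - ∏ p ∈ s, N' p (z p) (z' p)).PosSemidef := by
  induction s using Finset.induction_on with
  | empty =>
    constructor
    · convert Matrix.posSemidef_vecMulVec_self_star (fun _ : ι → X => (1 : ℂ)) using 1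
      ext z z'; simp [Matrix.vecMulVec_apply]
    · convert (Matrix.PosSemidef.zero : (0 : Matrix (ι → X) (ι → X) ℂ).PosSemidef) using 1
      ext z z'; simp
  | insert p s hp ih =>
    have e' := (h' p).submatrix (fun z : ι → X => z p)
    refine ⟨?_, ?_⟩
    · convert posSemidef_hadamard e' ih.1 using 1
      ext z z'; simp [Finset.prod_insert hp]
    · convert (posSemidef_hadamard ((h p).submatrix (fun z : ι → X => z p)) (ih.1.add ih.2)).add
        (posSemidef_hadamard e' ih.2) using 1
      ext z z'
      simp only [Matrix.of_apply, Finset.prod_insert hp, Matrix.add_apply, Matrix.hadamard_apply,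
        Matrix.submatrix_apply, Matrix.sub_apply]
      ring

theorem posSemidef_tensor {N : ι → Matrix X X ℂ} (h : ∀ p, (N p).PosSemidef) :
    (tensor N).PosSemidef :=
  (posSemidef_prod_sub_prod (N := N) h (fun p => by
    rw [sub_self]; exact Matrix.PosSemidef.zero) Finset.univ).1

theorem posSemidef_tensor_sub_tensor {N N' : ι → Matrix X X ℂ} (h' : ∀ p, (N' p).PosSemidef)
    (h : ∀ p, (N p - N' p).PosSemidef) : (tensor N - tensor N').PosSemidef :=
  (posSemidef_prod_sub_prod h' h Finset.univ).2

/-- The tensor product with factor `N` at `p` and `M` elsewhere. -/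
def tensorAt (M : Matrix X X ℂ) (p : ι) (N : Matrix X X ℂ) : Matrix (ι → X) (ι → X) ℂ :=
  tensor (Function.update (fun _ => M) p N)

omit [Fintype X] in
theorem tensorAt_apply (M : Matrix X X ℂ) (p : ι) (N : Matrix X X ℂ) (z z' : ι → X) :
    tensorAt M p N z z' = N (z p) (z' p) * ∏ q ∈ Finset.univ.erase p, M (z q) (z' q) := by
  rw [tensorAt, tensor, Matrix.of_apply, ← Finset.mul_prod_erase _ _ (Finset.mem_univ p),
    Function.update_self]
  congr 1
  refine Finset.prod_congr rfl fun q hq => ?_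
  rw [Function.update_of_ne (Finset.ne_of_mem_erase hq)]

theorem posSemidef_tensorAt {M N : Matrix X X ℂ} (hM : M.PosSemidef) (hN : N.PosSemidef) (p : ι) :
    (tensorAt M p N).PosSemidef := by
  refine posSemidef_tensor fun q => ?_
  rcases eq_or_ne q p with rfl | h
  · simpa using hN
  · simpa [Function.update_of_ne h] using hM

omit [Fintype X] in
theorem tensorAt_self (M : Matrix X X ℂ) (p : ι) : tensorAt M p M = tensor fun _ : ι => M := by
  rw [tensorAt, Function.update_eq_self]

omit [Fintype X] in
theorem tensorAt_add (M : Matrix X X ℂ) (p : ι) (N N' : Matrix X X ℂ) :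
    tensorAt M p (N + N') = tensorAt M p N + tensorAt M p N' := by
  ext z z'; simp [tensorAt_apply, add_mul]

omit [Fintype X] in
theorem tensorAt_sub (M : Matrix X X ℂ) (p : ι) (N N' : Matrix X X ℂ) :
    tensorAt M p (N - N') = tensorAt M p N - tensorAt M p N' := by
  ext z z'; simp [tensorAt_apply, sub_mul]

omit [Fintype X] in
theorem tensorAt_smul (M : Matrix X X ℂ) (p : ι) (c : ℂ) (N : Matrix X X ℂ) :
    tensorAt M p (c • N) = c • tensorAt M p N := by
  ext z z'; simp [tensorAt_apply, mul_assoc]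

end Tensor

/-! ## The energy of a family of states -/

section Energy

variable {Z B : Type*} [Fintype Z] [Fintype B]

/-- The pairing of `G` with the Gram matrix of the vectors `Φ z`. -/
noncomputable def energy (G : Matrix Z Z ℂ) (Φ : Z → B → ℂ) : ℝ :=
  (∑ z, ∑ z', G z z' * ∑ b, star (Φ z b) * Φ z' b).re

theorem energy_eq_sum_dotProduct (G : Matrix Z Z ℂ) (Φ : Z → B → ℂ) :
    energy G Φ = ∑ b, (star (fun z => Φ z b) ⬝ᵥ G *ᵥ fun z => Φ z b).re := by
  rw [energy, ← Complex.re_sum]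
  congr 1
  simp only [dotProduct, Matrix.mulVec, Finset.mul_sum, Pi.star_apply]
  rw [Finset.sum_comm_cycle, Finset.sum_comm_cycle]
  rw [Finset.sum_comm]
  refine Finset.sum_congr rfl fun z _ => ?_
  rw [Finset.sum_comm]
  refine Finset.sum_congr rfl fun z' _ => Finset.sum_congr rfl fun b _ => ?_
  ring

theorem energy_nonneg {G : Matrix Z Z ℂ} (hG : G.PosSemidef) (Φ : Z → B → ℂ) :
    0 ≤ energy G Φ := by
  rw [energy_eq_sum_dotProduct]
  exact Finset.sum_nonneg fun b _ => (Complex.le_def.1 (hG.dotProduct_mulVec_nonneg _)).1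

theorem energy_congr {B' : Type*} [Fintype B'] (G : Matrix Z Z ℂ) {Φ : Z → B → ℂ}
    {Φ' : Z → B' → ℂ}
    (h : ∀ z z', G z z' ≠ 0 → ∑ b, star (Φ z b) * Φ z' b = ∑ b, star (Φ' z b) * Φ' z' b) :
    energy G Φ = energy G Φ' := by
  unfold energy
  congr 1
  refine Finset.sum_congr rfl fun z _ => Finset.sum_congr rfl fun z' _ => ?_
  by_cases h0 : G z z' = 0
  · simp [h0]
  · rw [h z z' h0]

theorem energy_add (G G' : Matrix Z Z ℂ) (Φ : Z → B → ℂ) :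
    energy (G + G') Φ = energy G Φ + energy G' Φ := by
  simp [energy, add_mul, Finset.sum_add_distrib]

theorem energy_sub (G G' : Matrix Z Z ℂ) (Φ : Z → B → ℂ) :
    energy (G - G') Φ = energy G Φ - energy G' Φ := by
  simp [energy, sub_mul, Finset.sum_sub_distrib]

theorem energy_ofReal_smul (c : ℝ) (G : Matrix Z Z ℂ) (Φ : Z → B → ℂ) :
    energy ((c : ℂ) • G) Φ = c * energy G Φ := by
  unfold energy
  rw [← Complex.re_ofReal_mul]
  simp only [Matrix.smul_apply, smul_eq_mul, Finset.mul_sum, mul_assoc]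

/-- Splitting off the query register allows each queried variable to be bounded separately. -/
theorem energy_prod {I : Type*} [Fintype I] (G : Matrix Z Z ℂ) (Φ : Z → I × B → ℂ) :
    energy G Φ = ∑ i, energy G fun z b => Φ z (i, b) := by
  simp only [energy_eq_sum_dotProduct, Fintype.sum_prod_type]

end Energy

/-- If the Gram matrices of `Φ` and `Φ'` agree on the pairs whose `p`-th components are related by
`R`, their energies differ at most by the factor `1 + 2 / μ`. -/
theorem energy_tensor_le_of_gram_eq {ι X B : Type*} [Fintype ι] [DecidableEq ι] [Fintype X]
    [DecidableEq X] [Fintype B] {A M N : Matrix X X ℂ} {μ a : ℝ} (hμ : 0 < μ) (p : ι)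
    (R : X → X → Prop) (hR : ∀ x, R x x) (hMA : M = (a : ℂ) • 1 - A)
    (hN' : ∀ x y, ¬ R x y → N x y = A x y)
    (h₁ : (1 + N).PosSemidef) (h₂ : (1 - N).PosSemidef)
    (hM : (M - (μ : ℂ) • 1).PosSemidef) {Φ Φ' : (ι → X) → B → ℂ}
    (h : ∀ z z', R (z p) (z' p) → ∑ b, star (Φ z b) * Φ z' b = ∑ b, star (Φ' z b) * Φ' z' b) :
    energy (tensor fun _ => M) Φ' ≤ (1 + 2 / μ) * energy (tensor fun _ => M) Φ := by
  have hM0 : M.PosSemidef := by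
    have := hM.add (Matrix.PosSemidef.one.smul (show (0 : ℂ) ≤ (μ : ℂ) by exact_mod_cast hμ.le))
    simpa using this
  have key : ∀ L : Matrix X X ℂ, (∀ x y, ¬ R x y → L x y = 0) →
      energy (tensorAt M p L) Φ = energy (tensorAt M p L) Φ' := fun L hL => by
    refine energy_congr _ fun z z' h0 => h z z' ?_
    by_contra hr
    exact h0 (by rw [tensorAt_apply, hL _ _ hr, zero_mul])
  -- Both 1 and M + N vanish off `R`, so placing either of them at `p` gives a matrix whose energy
  -- is the same for `Φ` and `Φ'`.
  have k1 := key 1 fun x y hr => Matrix.one_apply_ne fun e => hr (e ▸ hR x)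
  have k2 := key (M + N) fun x y hr => by
    have hxy : x ≠ y := fun e => hr (e ▸ hR x)
    simp [hMA, Matrix.one_apply_ne hxy, hN' x y hr]
  have p1 := energy_nonneg (posSemidef_tensorAt hM0 h₁ p) Φ'
  have p2 := energy_nonneg (posSemidef_tensorAt hM0 h₂ p) Φ
  have p3 := energy_nonneg (posSemidef_tensorAt hM0 hM p) Φ
  rw [← tensorAt_self M p]
  simp only [tensorAt_add, tensorAt_sub, tensorAt_smul, energy_add, energy_sub,
    energy_ofReal_smul] at k2 p1 p2 p3
  -- Writing E_L for the energy with L at `p`: E_M(Φ') ≤ E_{M+N}(Φ') + E_1(Φ') = E_{M+N}(Φ) + E_1(Φ)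
  -- ≤ E_M(Φ) + 2 E_1(Φ). The last term is absorbed by M ⪰ μ I.
  have p4 : 2 * energy (tensorAt M p 1) Φ ≤ 2 / μ * energy (tensorAt M p M) Φ := by
    rw [div_mul_eq_mul_div, le_div_iff₀ hμ]
    linarith
  linarith

/-! ## Progress of a quantum query algorithm -/

section Algorithm

theorem star_unitary_mulVec_dotProduct {B : Type*} [Fintype B] [DecidableEq B]
    (U : Matrix.unitaryGroup B ℂ) (ψ φ : B → ℂ) :
    star (U.1 *ᵥ ψ) ⬝ᵥ U.1 *ᵥ φ = star ψ ⬝ᵥ φ := by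
  rw [Matrix.star_mulVec, Matrix.dotProduct_mulVec, Matrix.vecMul_vecMul,
    ← Matrix.star_eq_conjTranspose, Matrix.UnitaryGroup.star_mul_self, Matrix.vecMul_one]

theorem sum_star_smul_mul_smul {B : Type*} [Fintype B] (a c : ℂ) (ψ φ : B → ℂ) :
    ∑ b, star (a * ψ b) * (c * φ b) = star a * c * (star ψ ⬝ᵥ φ) := by
  simp only [dotProduct, Finset.mul_sum, star_mul', Pi.star_apply]
  exact Finset.sum_congr rfl fun b _ => by ring

theorem sum_star_applyQuery_mul {ι D : Type*} [Fintype D] [AddCommGroup D] {m : ℕ}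
    {x y : ι → D} {i : Option ι} (h : shift x i = shift y i) (ψ φ : BasisState ι D m → ℂ) :
    (∑ b, star (applyQuery x ψ (i, b)) * applyQuery y φ (i, b)) =
      ∑ b, star (ψ (i, b)) * φ (i, b) := by
  simp only [applyQuery, h]
  exact ((Equiv.subRight (shift y i)).prodCongr (Equiv.refl (Fin m))).sum_comp
    fun b => star (ψ (i, b)) * φ (i, b)

variable {n k : ℕ} {D O : Type*} [Fintype D] [DecidableEq D] [AddCommGroup D]
  {S : Finset (Fin n → D)}

/-- The input with blocks `z p`. -/
def joint (z : Fin k → S) : Fin k × Fin n → D := fun i => (z i.1).1 i.2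

/-- The states of the algorithm after `t` queries, weighted by the product amplitudes of `v`. -/
noncomputable def weightedState (A : Algorithm (Fin k × Fin n) D O) (v : S → ℂ) (t : ℕ)
    (z : Fin k → S) (b : BasisState (Fin k × Fin n) D A.workDim) : ℂ :=
  (∏ p, v (z p)) * A.state (joint z) t b

theorem star_state_zero_dotProduct (A : Algorithm (Fin k × Fin n) D O)
    (x y : Fin k × Fin n → D) : star (A.state x 0) ⬝ᵥ A.state y 0 = 1 := by
  simp only [Algorithm.state]
  rw [star_unitary_mulVec_dotProduct]
  simp

/-- Before any query the state does not depend on the input, so all its inner products are 1 and the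
double sum factors over the blocks. -/
theorem energy_weightedState_zero (A : Algorithm (Fin k × Fin n) D O) (v : S → ℂ)
    (M : Matrix S S ℂ) {r : ℝ} (hr : star v ⬝ᵥ M *ᵥ v = r) :
    energy (tensor fun _ : Fin k => M) (weightedState A v 0) = r ^ k := by
  have h : ∀ z z' : Fin k → S, (tensor fun _ : Fin k => M) z z' *
      ∑ b, star (weightedState A v 0 z b) * weightedState A v 0 z' b =
      ∏ p, star (v (z p)) * (M (z p) (z' p) * v (z' p)) := fun z z' => by
    simp only [weightedState]
    rw [sum_star_smul_mul_smul, star_state_zero_dotProduct, tensor, Matrix.of_apply, star_prod,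
      mul_one, ← Finset.prod_mul_distrib, ← Finset.prod_mul_distrib]
    exact Finset.prod_congr rfl fun p _ => by ring
  rw [energy]
  simp only [h]
  have : ∑ z : Fin k → S, ∑ z' : Fin k → S, ∏ p, star (v (z p)) * (M (z p) (z' p) * v (z' p))
      = (star v ⬝ᵥ M *ᵥ v) ^ k := by
    set g : S → S → ℂ := fun x y => star (v x) * (M x y * v y)
    have e : ∀ z : Fin k → S, ∑ z' : Fin k → S, ∏ p, g (z p) (z' p) = ∏ p, ∑ y, g (z p) y :=
      fun z => (Fintype.prod_sum fun p y => g (z p) y).symm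
    rw [Finset.sum_congr rfl fun z _ => e z, ← Fintype.prod_sum fun (_ : Fin k) x => ∑ y, g x y,
      Finset.prod_const, Finset.card_univ, Fintype.card_fin]
    simp only [g, dotProduct, Matrix.mulVec, Finset.mul_sum, Pi.star_apply]
  rw [this, hr, ← Complex.ofReal_pow, Complex.ofReal_re]

/-- The unitary preserves Gram matrices. On the part with index (p, q), the query preserves inner
products between inputs whose p-th blocks agree at q, so only the tensor factor p is affected. -/
theorem energy_weightedState_succ_le (A : Algorithm (Fin k × Fin n) D O) (v : S → ℂ)
    {H M : Matrix S S ℂ} {μ a : ℝ} (hμ : 0 < μ) (hMH : M = (a : ℂ) • 1 - H)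
    (h₁ : ∀ i, (1 + H ⊙ (allOnes S - agree S i)).PosSemidef)
    (h₂ : ∀ i, (1 - H ⊙ (allOnes S - agree S i)).PosSemidef)
    (hM : (M - (μ : ℂ) • 1).PosSemidef) (t : ℕ) :
    energy (tensor fun _ : Fin k => M) (weightedState A v (t + 1)) ≤
      (1 + 2 / μ) * energy (tensor fun _ : Fin k => M) (weightedState A v t) := by
  have hM0 : M.PosSemidef := by
    have := hM.add (Matrix.PosSemidef.one.smul (show (0 : ℂ) ≤ (μ : ℂ) by exact_mod_cast hμ.le))
    simpa using this
  have hU : energy (tensor fun _ : Fin k => M) (weightedState A v (t + 1)) =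
      energy (tensor fun _ : Fin k => M)
        fun z b => (∏ p, v (z p)) * applyQuery (joint z) (A.state (joint z) t) b :=
    energy_congr _ fun z z' _ => by
      simp only [weightedState, Algorithm.state]
      rw [sum_star_smul_mul_smul, sum_star_smul_mul_smul, star_unitary_mulVec_dotProduct]
  have hq : ∀ (i : Option (Fin k × Fin n)) (z z' : Fin k → S),
      shift (joint z) i = shift (joint z') i →
      ∑ b, star (weightedState A v t z (i, b)) * weightedState A v t z' (i, b) =
        ∑ b, star ((∏ p, v (z p)) * applyQuery (joint z) (A.state (joint z) t) (i, b)) *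
          ((∏ p, v (z' p)) * applyQuery (joint z') (A.state (joint z') t) (i, b)) := by
    intro i z z' h
    simp only [weightedState]
    rw [sum_star_smul_mul_smul _ _ (fun b => A.state (joint z) t (i, b))
        (fun b => A.state (joint z') t (i, b)),
      sum_star_smul_mul_smul _ _ (fun b => applyQuery (joint z) (A.state (joint z) t) (i, b))
        (fun b => applyQuery (joint z') (A.state (joint z') t) (i, b))]
    congr 1
    exact (sum_star_applyQuery_mul h _ _).symm
  rw [hU, energy_prod, energy_prod, Finset.mul_sum]
  refine Finset.sum_le_sum fun i _ => ?_
  rcases i with _ | ⟨p, q⟩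
  -- The idle index leaves every inner product, hence the energy, unchanged.
  · rw [← energy_congr _ fun z z' _ => hq none z z' rfl]
    refine le_mul_of_one_le_left (energy_nonneg (posSemidef_tensor fun _ => hM0) _) ?_
    have : 0 < 2 / μ := by positivity
    linarith
  · refine energy_tensor_le_of_gram_eq hμ p (fun x y : S => x.1 q = y.1 q) (fun _ => rfl) hMH
      ?_ (h₁ q) (h₂ q) hM fun z z' h => hq (some (p, q)) z z' h
    intro x y hxy
    simp [allOnes, agree, hxy]

/-- For each measurement outcome b, M^{⊗k} dominates c^k times the projection onto the inputs whose
value is the output attached to b. Summing over b collects exactly the weighted success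
probabilities. -/
theorem sum_norm_sq_mul_outputProb_le_energy {E : Type*} [DecidableEq E]
    (A : Algorithm (Fin k × Fin n) D (Fin k → E)) (v : S → ℂ) (f : S → E) {M : Matrix S S ℂ}
    {c : ℝ} (hc : 0 ≤ c)
    (hM : ∀ o, (M - (c : ℂ) • Matrix.diagonal fun x => if f x = o then (1 : ℂ) else 0).PosSemidef) :
    c ^ k * ∑ z : Fin k → S, ‖∏ p, v (z p)‖ ^ 2 *
        A.outputProb (joint z) (fun p => f (z p)) ≤
      energy (tensor fun _ : Fin k => M) (weightedState A v A.queries) := by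
  classical
  have hP : ∀ o : E,
      ((c : ℂ) • Matrix.diagonal fun x : S => if f x = o then (1 : ℂ) else 0).PosSemidef :=
    fun o => (Matrix.PosSemidef.diagonal fun x => by
      simp only [Pi.zero_apply]; split_ifs <;> simp).smul (by exact_mod_cast hc)
  have hT : ∀ o : Fin k → E,
      (tensor fun p => (c : ℂ) • Matrix.diagonal fun x : S => if f x = o p then (1 : ℂ) else 0) =
        Matrix.diagonal fun z => if (fun p => f (z p)) = o then ((c ^ k : ℝ) : ℂ) else 0 := by
    intro o
    ext z z'
    simp only [tensor, Matrix.of_apply, Matrix.smul_apply, smul_eq_mul]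
    by_cases h : z = z'
    · subst h
      simp only [Matrix.diagonal_apply_eq]
      rw [Finset.prod_mul_distrib, Finset.prod_const, Finset.card_univ, Fintype.card_fin,
        Finset.prod_ite_zero]
      simp [funext_iff]
    · obtain ⟨p, hp⟩ := Function.ne_iff.1 h
      rw [Matrix.diagonal_apply_ne _ h]
      exact Finset.prod_eq_zero (Finset.mem_univ p) (by rw [Matrix.diagonal_apply_ne _ hp, mul_zero])
  have hb : ∀ b, (∑ z : Fin k → S, if A.output b = (fun p => f (z p)) then
      c ^ k * (‖∏ p, v (z p)‖ ^ 2 * ‖A.state (joint z) A.queries b‖ ^ 2) else 0) ≤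
      (star (fun z => weightedState A v A.queries z b) ⬝ᵥ (tensor fun _ : Fin k => M) *ᵥ
        fun z => weightedState A v A.queries z b).re := by
    intro b
    have h := (posSemidef_tensor_sub_tensor (fun p => hP (A.output b p))
      (fun p => hM (A.output b p))).dotProduct_mulVec_nonneg
        (fun z => weightedState A v A.queries z b)
    have h' := (Complex.le_def.1 h).1
    rw [Matrix.sub_mulVec, dotProduct_sub, Complex.sub_re, Complex.zero_re, sub_nonneg, hT] at h'
    refine le_trans (le_of_eq ?_) h'
    rw [dotProduct, Complex.re_sum]
    refine Finset.sum_congr rfl fun z _ => ?_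
    rw [Matrix.mulVec_diagonal]
    by_cases hz : A.output b = fun p => f (z p)
    · rw [if_pos hz, if_pos hz.symm, Pi.star_apply, mul_left_comm (star _), RCLike.star_def,
        Complex.conj_mul', ← Complex.ofReal_pow, ← Complex.ofReal_mul, Complex.ofReal_re,
        weightedState, norm_mul, mul_pow]
    · rw [if_neg hz, if_neg fun h => hz h.symm]
      simp
  rw [energy_eq_sum_dotProduct]
  refine le_trans (le_of_eq ?_) (Finset.sum_le_sum fun b _ => hb b)
  rw [Finset.sum_comm, Finset.mul_sum]
  refine Finset.sum_congr rfl fun z _ => ?_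
  rw [Algorithm.outputProb, ← Finset.sum_filter, Finset.mul_sum, Finset.mul_sum]
  congr 1
  ext b
  simp

omit [Fintype D] [DecidableEq D] [AddCommGroup D] in
theorem sum_norm_sq_prod_eq_one {v : S → ℂ} (hv : star v ⬝ᵥ v = 1) :
    ∑ z : Fin k → S, ‖∏ p, v (z p)‖ ^ 2 = 1 := by
  have h : ∑ x, ‖v x‖ ^ 2 = 1 := by
    rw [star_dotProduct_self_eq_norm_sq, EuclideanSpace.norm_sq_eq] at hv
    exact_mod_cast hv
  simp only [norm_prod, ← Finset.prod_pow]
  rw [← Fintype.prod_sum fun (_ : Fin k) x => ‖v x‖ ^ 2, h, Finset.prod_const_one]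

end Algorithm

/-! ## The direct product theorem -/

/-- The success probability of a `T`-query algorithm for `f^(k)` is at most
`((d + μ) / (2 d + μ)) ^ k * (1 + 2 / μ) ^ T`, for every `μ > 0` and every adversary bound `d`. -/
theorem success_le_of_isAdversaryMatrix {n k : ℕ} {D E : Type*} [Fintype D] [DecidableEq D]
    [AddCommGroup D] [Fintype E] [DecidableEq E] (hE : Fintype.card E = 2)
    {S : Finset (Fin n → D)} (f : S → E) {Γ : Matrix S S ℂ} (hΓ : IsAdversaryMatrix Γ) {d μ η : ℝ}
    (hdΓ : d = ‖Matrix.toEuclideanCLM (𝕜 := ℂ) (Γ ⊙ (allOnes S - functionGram f))‖)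
    (hd : 0 < d) (hμ : 0 < μ) (A : Algorithm (Fin k × Fin n) D (Fin k → E))
    (hA : A.Computes (copies f k) (1 - η)) :
    η ≤ ((d + μ) / (2 * d + μ)) ^ k * (1 + 2 / μ) ^ A.queries := by
  set H := Γ ⊙ (allOnes S - functionGram f) with hH
  have hHapp : ∀ x y, H x y = if f x = f y then 0 else Γ x y := fun x y => by
    simp only [hH, allOnes, functionGram, Matrix.hadamard_apply, Matrix.sub_apply, Matrix.of_apply]
    split_ifs <;> simp
  have hHf : ∀ x y, f x = f y → H x y = 0 := fun x y h => by rw [hHapp, if_pos h]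
  have hHherm : H.IsHermitian := by
    ext x y
    rw [Matrix.conjTranspose_apply, hHapp, hHapp]
    by_cases h : f x = f y
    · simp [h]
    · rw [if_neg h, if_neg (Ne.symm h), hΓ.1.apply]
  have hne : Nonempty S := by
    by_contra hS
    have : IsEmpty S := not_nonempty_iff.1 hS
    have h0 : H = 0 := Subsingleton.elim _ _
    rw [h0, map_zero, norm_zero] at hdΓ
    exact hd.ne' hdΓ
  obtain ⟨v, hv1, hvd⟩ := exists_unit_dotProduct_mulVec_eq_norm hE f hHherm hHf
  rw [← hdΓ] at hvd
  have hdH := posSemidef_norm_smul_one_sub hHherm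
  rw [← hdΓ] at hdH
  set M : Matrix S S ℂ := ((d + μ : ℝ) : ℂ) • 1 - H with hMdef
  have hMμ : (M - (μ : ℂ) • 1).PosSemidef := by
    convert hdH using 1
    rw [hMdef, Complex.ofReal_add, add_smul]
    abel
  have hHi : ∀ i x y, (H ⊙ (allOnes S - agree S i)) x y =
      if f x = f y then 0 else (Γ ⊙ (allOnes S - agree S i)) x y := fun i x y => by
    rw [Matrix.hadamard_apply, hHapp, Matrix.hadamard_apply]
    split_ifs <;> simp
  -- The constraints on Γ pass to H, since deleting the entries inside the fibres of a boolean
  -- function preserves them.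
  have h₁ : ∀ i, (1 + H ⊙ (allOnes S - agree S i)).PosSemidef := fun i =>
    posSemidef_one_add_of_offFibre hE f (hHi i) (hΓ.2 i).1 (hΓ.2 i).2
  have h₂ : ∀ i, (1 - H ⊙ (allOnes S - agree S i)).PosSemidef := fun i => by
    rw [sub_eq_add_neg]
    refine posSemidef_one_add_of_offFibre hE f (B := -(Γ ⊙ (allOnes S - agree S i))) ?_ ?_ ?_
    · intro x y
      rw [Matrix.neg_apply, hHi, Matrix.neg_apply]
      split_ifs <;> simp
    · rw [← sub_eq_add_neg]; exact (hΓ.2 i).2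
    · rw [sub_neg_eq_add]; exact (hΓ.2 i).1
  set c : ℝ := μ * (2 * d + μ) / (d + μ) with hc
  have hc0 : 0 < c := by positivity
  have hfin := sum_norm_sq_mul_outputProb_le_energy A v f hc0.le
    fun o => posSemidef_smul_one_sub_sub_fibre hE f o hHf hd hμ hdH
  have hsucc : ∀ z : Fin k → S, η ≤ A.outputProb (joint z) (fun p => f (z p)) := fun z => by
    have hz : joint z ∈ powDomain S k := Finset.mem_filter.2
      ⟨Finset.mem_univ _, fun p => (z p).2⟩
    have := hA ⟨joint z, hz⟩
    rw [sub_sub_cancel] at this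
    exact this
  have hη : η ≤ ∑ z : Fin k → S, ‖∏ p, v (z p)‖ ^ 2 *
      A.outputProb (joint z) (fun p => f (z p)) := by
    calc η = ∑ z : Fin k → S, ‖∏ p, v (z p)‖ ^ 2 * η := by
          rw [← Finset.sum_mul, sum_norm_sq_prod_eq_one hv1, one_mul]
      _ ≤ _ := Finset.sum_le_sum fun z _ => mul_le_mul_of_nonneg_left (hsucc z) (by positivity)
  have hvM : star v ⬝ᵥ M *ᵥ v = (μ : ℂ) := by
    rw [hMdef, Matrix.sub_mulVec, dotProduct_sub, hvd, Matrix.smul_mulVec, Matrix.one_mulVec,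
      dotProduct_smul, hv1]
    simp
  have hup : ∀ t, energy (tensor fun _ : Fin k => M) (weightedState A v t) ≤
      μ ^ k * (1 + 2 / μ) ^ t := by
    intro t
    induction t with
    | zero => rw [energy_weightedState_zero A v M hvM, pow_zero, mul_one]
    | succ t ih =>
      calc _ ≤ _ := energy_weightedState_succ_le A v hμ hMdef h₁ h₂ hMμ t
        _ ≤ (1 + 2 / μ) * (μ ^ k * (1 + 2 / μ) ^ t) := mul_le_mul_of_nonneg_left ih (by positivity)
        _ = _ := by ring
  have hfinal : c ^ k * η ≤ μ ^ k * (1 + 2 / μ) ^ A.queries :=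
    (mul_le_mul_of_nonneg_left hη (by positivity)).trans (hfin.trans (hup _))
  have hcd : c * ((d + μ) / (2 * d + μ)) = μ := by rw [hc]; field_simp
  rw [← hcd, mul_pow, hcd, mul_assoc] at hfinal
  exact le_of_mul_le_mul_left hfinal (by positivity)

end QuantumQuery

theorem mainTheorem9 {n : ℕ} {D E : Type*} [Fintype D] [DecidableEq D] [AddCommGroup D]
    [Fintype E] [DecidableEq E] (hE : Fintype.card E = 2)
    (S : Finset (Fin n → D)) (f : S → E)
    (δ : ℝ) (hδ0 : 0 ≤ δ) (hδ1 : δ < 1) (k K : ℕ) (hk : 0 < k) (hK : 0 < K) :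
    ENNReal.ofReal ((k : ℝ) * δ / ((K : ℝ) * (1 - δ))) *
        QuantumQuery.additiveAdversary (QuantumQuery.functionGram f) ≤
      ((QuantumQuery.queryComplexity
          (1 - (Real.exp (1 / (K : ℝ)) * (1 + √δ) / 2) ^ k)
          (QuantumQuery.copies f k) : ℕ∞) : ℝ≥0∞) := by
  open QuantumQuery in
  have hkR : (0 : ℝ) < k := by exact_mod_cast hk
  have hKR : (0 : ℝ) < K := by exact_mod_cast hK
  have h1δ : 0 < 1 - δ := by linarith
  have hcoef : 0 ≤ (k : ℝ) * δ / ((K : ℝ) * (1 - δ)) := by positivity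
  rw [queryComplexity, ENat.toENNReal_iInf]
  refine le_iInf fun A => ?_
  rw [ENat.toENNReal_iInf]
  refine le_iInf fun hA => ?_
  rw [additiveAdversary]
  simp only [ENNReal.mul_iSup]
  refine iSup_le fun Γ => iSup_le fun hΓ => ?_
  rw [← ENNReal.ofReal_mul hcoef, ENat.toENNReal_coe, ← ENNReal.ofReal_natCast]
  refine ENNReal.ofReal_le_ofReal ?_
  obtain ⟨d, hdΓ⟩ : ∃ d, d = ‖Matrix.toEuclideanCLM (𝕜 := ℂ)
    (Γ ⊙ (allOnes S - functionGram f))‖ := ⟨_, rfl⟩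
  rw [← hdΓ]
  have hd0 : 0 ≤ d := hdΓ ▸ norm_nonneg _
  -- If δ = 0 or d = 0 the bound is trivial; these cases are split off because μ below must be
  -- positive.
  rcases hδ0.eq_or_lt with rfl | hδ
  · simp
  rcases hd0.eq_or_lt with h0 | hd
  · rw [← h0]; simp
  obtain ⟨s, hs0, hsδ, hs⟩ : ∃ s : ℝ, 0 < s ∧ s ^ 2 = δ ∧ √δ = s :=
    ⟨√δ, Real.sqrt_pos.2 hδ, Real.sq_sqrt hδ0, rfl⟩
  rw [hs] at hA
  have hs1 : 0 < 1 - s := by nlinarith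
  -- This μ solves (d + μ)/(2d + μ) = (1 + s)/2, cancelling the factor ((1 + √δ)/2)^k of the success
  -- probability and leaving e^{k/K} ≤ (1 + 2/μ)^T.
  set μ : ℝ := 2 * d * s / (1 - s) with hμdef
  have hμ : 0 < μ := by positivity
  have h := success_le_of_isAdversaryMatrix hE f hΓ hdΓ hd hμ A hA
  have hratio : (d + μ) / (2 * d + μ) = (1 + s) / 2 := by
    rw [hμdef]; field_simp; ring
  have hexp : (1 + 2 / μ) ^ A.queries ≤ Real.exp (2 / μ * A.queries) := by
    rw [mul_comm, Real.exp_nat_mul]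
    refine pow_le_pow_left₀ (by positivity) ?_ _
    linarith [Real.add_one_le_exp (2 / μ)]
  have hle : Real.exp (k * (1 / (K : ℝ))) ≤ Real.exp (2 / μ * A.queries) := by
    have hpos : 0 < ((1 + s) / 2) ^ k := by positivity
    rw [hratio] at h
    have h' : ((1 + s) / 2) ^ k * Real.exp (k * (1 / (K : ℝ))) ≤
        ((1 + s) / 2) ^ k * Real.exp (2 / μ * A.queries) := by
      refine le_trans (le_of_eq ?_) (h.trans (mul_le_mul_of_nonneg_left hexp hpos.le))
      rw [Real.exp_nat_mul, ← mul_pow]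
      ring
    exact le_of_mul_le_mul_left h' hpos
  have hlin := Real.exp_le_exp.1 hle
  have hT : (k : ℝ) * μ ≤ 2 * K * A.queries := by
    rw [mul_one_div, div_mul_eq_mul_div, div_le_div_iff₀ hKR hμ] at hlin
    linarith
  -- The argument yields the factor s/(1 - s), which is at least s²/(1 - s²) = δ/(1 - δ).
  have hbound : (k : ℝ) * δ / (K * (1 - δ)) * d ≤ k * μ / (2 * K) := by
    have e1 : (k : ℝ) * μ / (2 * K) = k / K * d * (s / (1 - s)) := by
      rw [hμdef]; field_simp
    have e2 : (k : ℝ) * δ / (K * (1 - δ)) * d = k / K * d * (δ / (1 - δ)) := by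
      field_simp
    rw [e1, e2]
    refine mul_le_mul_of_nonneg_left ?_ (by positivity)
    rw [div_le_div_iff₀ h1δ hs1, ← hsδ]
    nlinarith [mul_pos hs0 hs1]
  refine hbound.trans ?_
  rw [div_le_iff₀ (by positivity)]
  linarith
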